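/- Let $(X,\mu)$ be a standard $\sigma$-finite measure space. Let $T(X)=L^2(X)\hat\otimes L^2(X)$ be the Banach space projective tensor product, viewed as the space of all functions $h:X\times X\to\mathbb C$ (identified when equal $\mu\times\mu$-almost everywhere) of the form $h(s,t)=\sum_{i=1}^\infty f_i(s)g_i(t)$ with square summable sequences $(f_i),(g_i)$ in $L^2(X)$. The pairing $\langle K,h\rangle=\sum_{i=1}^\infty (Kf_i,\overline{g_i})$ identifies $T(X)$ with the dual of the space $\mathcal K$ of all compact operators on $L^2(X)$, and the weak* topology of $T(X)$ is the one arising in this way, that is, the coarsest topology making $h\mapsto\langle K,h\rangle$ continuous for every $K\in\mathcal K$. Let $\mathfrak S(X)$ be the set of all Schur multipliers, that is, of all measurable, essentially bounded functions $\varphi:X\times X\to\mathbb C$ such that $\varphi h$ is equivalent (with respect to $\mu\times\mu$) to a function in $T(X)$ for every $h\in T(X)$. Let $\mathcal S,\mathcal T\subseteq T(X)$ be (not necessarily closed) linear subspaces that are $\mathfrak S(X)$-invariant, i.e. $\varphi h\in\mathcal S$ for all $\varphi\in\mathfrak S(X)$, $h\in\mathcal S$, and likewise for $\mathcal T$. If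 $\mathcal S+\mathcal T$ is weak* dense in $T(X)$, then $$\overline{\mathcal S}^{\,w^*}\cap\overline{\mathcal T}^{\,w^*}=\overline{\mathcal S\cap\mathcal T}^{\,w^*}.$$ -/

import Mathlib

open MeasureTheory
open scoped ENNReal Topology ComplexConjugate

namespace SchurMult

variable {X : Type*} [MeasurableSpace X]

/-- The Hilbert space `L²(X, μ)` of complex-valued functions. -/
noncomputable abbrev L2 (μ : Measure X) : Type _ := Lp ℂ 2 μ

/-- `h = ∑ i, f i ⊗ g i` for square summable sequences `f`, `g` in `L²(X)`: the series
`∑ i, f i s * g i t` converges (absolutely) to `h (s, t)` for almost every `(s, t)`. -/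
structure IsRep (μ : Measure X) (f g : ℕ → L2 μ) (h : X × X →ₘ[μ.prod μ] ℂ) : Prop where
  summable_left : Summable fun i => ‖f i‖ ^ 2
  summable_right : Summable fun i => ‖g i‖ ^ 2
  hasSum : ∀ᵐ p ∂(μ.prod μ), HasSum (fun i => f i p.1 * g i p.2) (h p)

theorem IsRep.zero (μ : Measure X) [SigmaFinite μ] : IsRep μ 0 0 0 := by
  refine ⟨by simp, by simp, ?_⟩
  have h1 : ∀ᵐ p ∂(μ.prod μ), ((0 : L2 μ) : X → ℂ) p.1 = 0 :=
    Measure.quasiMeasurePreserving_fst.ae (Lp.coeFn_zero ℂ 2 μ)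
  filter_upwards [h1, AEEqFun.coeFn_zero (μ := μ.prod μ) (β := ℂ)] with p hp hz
  simp only [Pi.zero_apply] at hz ⊢
  rw [hz]
  simp only [hp, zero_mul]
  exact hasSum_zero

theorem IsRep.smul {μ : Measure X} [SigmaFinite μ] {f g : ℕ → L2 μ}
    {h : X × X →ₘ[μ.prod μ] ℂ} (c : ℂ) (H : IsRep μ f g h) :
    IsRep μ (fun i => c • f i) g (c • h) := by
  refine ⟨?_, H.summable_right, ?_⟩
  · simpa [norm_smul, mul_pow] using H.summable_left.mul_left (‖c‖ ^ 2)
  · have h1 : ∀ᵐ p ∂(μ.prod μ), ∀ i, (c • f i : L2 μ) p.1 = c * f i p.1 := by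
      rw [ae_all_iff]
      intro i
      exact Measure.quasiMeasurePreserving_fst.ae (Lp.coeFn_smul c (f i))
    filter_upwards [h1, AEEqFun.coeFn_smul c h, H.hasSum] with p hp hs hh
    rw [hs]
    simp only [hp, Pi.smul_apply, smul_eq_mul, mul_assoc]
    exact hh.mul_left c

theorem IsRep.add {μ : Measure X} [SigmaFinite μ] {f g f' g' : ℕ → L2 μ}
    {h h' : X × X →ₘ[μ.prod μ] ℂ} (H : IsRep μ f g h) (H' : IsRep μ f' g' h') :
    ∃ F G, IsRep μ F G (h + h') := by
  let e : ℕ ≃ ℕ ⊕ ℕ := Equiv.natSumNatEquivNat.symm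
  refine ⟨fun n => Sum.elim f f' (e n), fun n => Sum.elim g g' (e n), ?_, ?_, ?_⟩
  · refine (e.summable_iff (f := fun x => ‖Sum.elim f f' x‖ ^ 2)).2 ?_
    exact (HasSum.sum (f := fun x => ‖Sum.elim f f' x‖ ^ 2)
      H.summable_left.hasSum H'.summable_left.hasSum).summable
  · refine (e.summable_iff (f := fun x => ‖Sum.elim g g' x‖ ^ 2)).2 ?_
    exact (HasSum.sum (f := fun x => ‖Sum.elim g g' x‖ ^ 2)
      H.summable_right.hasSum H'.summable_right.hasSum).summable
  · filter_upwards [AEEqFun.coeFn_add h h', H.hasSum, H'.hasSum] with p hs hh hh'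
    rw [hs]
    refine (e.hasSum_iff
      (f := fun x => (Sum.elim f f' x : L2 μ) p.1 * (Sum.elim g g' x : L2 μ) p.2)).2 ?_
    exact HasSum.sum
      (f := fun x => (Sum.elim f f' x : L2 μ) p.1 * (Sum.elim g g' x : L2 μ) p.2) hh hh'

/-- The space `T(X) = L²(X) ⊗̂ L²(X)` (projective tensor product), realized as the space of all
(classes modulo `μ × μ`-null sets of) functions `h (s, t) = ∑ i, f i s * g i t` on `X × X`,
where `f`, `g` are square summable sequences in `L²(X)`. -/
noncomputable def traceSpace (μ : Measure X) [SigmaFinite μ] :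
    Submodule ℂ (X × X →ₘ[μ.prod μ] ℂ) where
  carrier := {h | ∃ f g : ℕ → L2 μ, IsRep μ f g h}
  zero_mem' := ⟨0, 0, IsRep.zero μ⟩
  add_mem' := by
    rintro h h' ⟨f, g, H⟩ ⟨f', g', H'⟩
    exact H.add H'
  smul_mem' := by
    rintro c h ⟨f, g, H⟩
    exact ⟨_, _, H.smul c⟩

/-- The pairing `⟨K, h⟩ = ∑ i, (K (f i), conj (g i))`, for `h = ∑ i, f i ⊗ g i` in `T(X)` and a
bounded operator `K` on `L²(X)`. (Mathlib's `inner` is linear in its second variable.)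
It does not depend on the representation of `h`, see `pairing_eq_tsum`. -/
noncomputable def pairing (μ : Measure X) [SigmaFinite μ] (K : L2 μ →L[ℂ] L2 μ)
    (h : traceSpace μ) : ℂ :=
  ∑' i, inner ℂ (star (h.2.choose_spec.choose i)) (K (h.2.choose i))

theorem inner_star_left {μ : Measure X} (g η : L2 μ) :
    inner ℂ (star g) η = ∫ t, g t * η t ∂μ := by
  rw [L2.inner_def]
  refine integral_congr_ae ?_
  filter_upwards [Lp.coeFn_star g] with t ht
  rw [ht]
  simp [mul_comm]

theorem norm_star_L2 {μ : Measure X} (g : L2 μ) : ‖star g‖ = ‖g‖ := by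
  rw [Lp.norm_def, Lp.norm_def]
  congr 1
  refine eLpNorm_congr_norm_ae ?_
  filter_upwards [Lp.coeFn_star g] with t ht
  rw [ht]
  simp

theorem integrable_mul_L2 {μ : Measure X} (f g : L2 μ) : Integrable (fun s => f s * g s) μ :=
  (Lp.memLp f).integrable_mul (Lp.memLp g)

theorem integral_norm_mul_le {μ : Measure X} (f g : L2 μ) :
    ∫ s, ‖f s‖ * ‖g s‖ ∂μ ≤ ‖f‖ * ‖g‖ := by
  let F : Lp ℝ 2 μ := (Lp.memLp f).norm.toLp
  let G : Lp ℝ 2 μ := (Lp.memLp g).norm.toLp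
  have hF : ‖F‖ = ‖f‖ := by
    rw [Lp.norm_toLp, eLpNorm_norm, Lp.norm_def]
  have hG : ‖G‖ = ‖g‖ := by
    rw [Lp.norm_toLp, eLpNorm_norm, Lp.norm_def]
  have h1 : ∫ s, ‖f s‖ * ‖g s‖ ∂μ = inner ℝ F G := by
    rw [L2.inner_def]
    refine integral_congr_ae ?_
    filter_upwards [(Lp.memLp f).norm.coeFn_toLp, (Lp.memLp g).norm.coeFn_toLp] with s hf hg
    rw [hf, hg]
    simp [mul_comm]
  rw [h1, ← hF, ← hG]
  exact real_inner_le_norm F G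

theorem IsRep.hasSum_inner_mul_inner {μ : Measure X} [SigmaFinite μ] {f g : ℕ → L2 μ}
    {h : X × X →ₘ[μ.prod μ] ℂ} (H : IsRep μ f g h) (ξ η : L2 μ) :
    HasSum (fun i => inner ℂ ξ (f i) * inner ℂ (star (g i)) η)
      (∫ p, h p * (conj (ξ p.1) * η p.2) ∂(μ.prod μ)) := by
  have e1 : ∀ i, inner ℂ ξ (f i) * inner ℂ (star (g i)) η =
      ∫ p, (f i p.1 * (star ξ : L2 μ) p.1) * (g i p.2 * η p.2) ∂(μ.prod μ) := by
    intro i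
    rw [integral_prod_mul (fun s => f i s * (star ξ : L2 μ) s) (fun t => g i t * η t),
      inner_star_left]
    congr 1
    rw [← inner_star_left (f i), L2.inner_def, L2.inner_def]
    refine integral_congr_ae ?_
    filter_upwards [Lp.coeFn_star (f i), Lp.coeFn_star ξ] with s h1 h2
    rw [h1, h2]
    simp [mul_comm]
  have hint : ∀ i, Integrable
      (fun p : X × X => (f i p.1 * (star ξ : L2 μ) p.1) * (g i p.2 * η p.2)) (μ.prod μ) :=
    fun i => (integrable_mul_L2 (f i) (star ξ)).mul_prod (integrable_mul_L2 (g i) η)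
  have hsum : Summable fun i =>
      ∫ p, ‖(f i p.1 * (star ξ : L2 μ) p.1) * (g i p.2 * η p.2)‖ ∂(μ.prod μ) := by
    have hb : Summable fun i => (‖f i‖ ^ 2 + ‖g i‖ ^ 2) * (‖(star ξ : L2 μ)‖ * ‖η‖) :=
      (H.summable_left.add H.summable_right).mul_right _
    refine Summable.of_nonneg_of_le (fun i => integral_nonneg fun _ => norm_nonneg _) ?_ hb
    intro i
    simp only [norm_mul]
    rw [integral_prod_mul (fun s => ‖f i s‖ * ‖(star ξ : L2 μ) s‖) (fun t => ‖g i t‖ * ‖η t‖)]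
    calc _ ≤ (‖f i‖ * ‖(star ξ : L2 μ)‖) * (‖g i‖ * ‖η‖) :=
          mul_le_mul (integral_norm_mul_le _ _) (integral_norm_mul_le _ _)
            (integral_nonneg fun _ => by positivity) (by positivity)
      _ = (‖f i‖ * ‖g i‖) * (‖(star ξ : L2 μ)‖ * ‖η‖) := by ring
      _ ≤ _ := by
          refine mul_le_mul_of_nonneg_right ?_ (by positivity)
          nlinarith [sq_nonneg (‖f i‖ - ‖g i‖), sq_nonneg ‖f i‖, sq_nonneg ‖g i‖]
  have key := hasSum_integral_of_summable_integral_norm hint hsum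
  simp only [e1]
  convert! key using 1
  refine integral_congr_ae ?_
  have h2 : ∀ᵐ p ∂(μ.prod μ), (star ξ : L2 μ) p.1 = conj (ξ p.1) :=
    Measure.quasiMeasurePreserving_fst.ae (Lp.coeFn_star ξ)
  filter_upwards [H.hasSum, h2] with p hp hξ
  rw [← (hp.mul_right (conj (ξ p.1) * η p.2)).tsum_eq]
  refine tsum_congr fun i => ?_
  rw [hξ]
  ring

theorem hasSum_norm_sq_inner {μ : Measure X} {ι : Type*} (b : HilbertBasis ι ℂ (L2 μ))
    (x : L2 μ) : HasSum (fun j => ‖inner ℂ x (b j)‖ ^ 2) (‖x‖ ^ 2) := by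
  have h1 := b.hasSum_inner_mul_inner x x
  have h2 := Complex.hasSum_re h1
  convert! h2 using 1
  · ext j
    rw [← inner_conj_symm (b j) x, Complex.mul_conj, Complex.ofReal_re, Complex.normSq_eq_norm_sq]
  · exact norm_sq_eq_re_inner (𝕜 := ℂ) x

theorem IsRep.summable_inner {μ : Measure X} {f g : ℕ → L2 μ}
    {h : X × X →ₘ[μ.prod μ] ℂ} (H : IsRep μ f g h) (K : L2 μ →L[ℂ] L2 μ) {ι : Type*}
    (b : HilbertBasis ι ℂ (L2 μ)) :
    Summable fun q : ℕ × ι => inner ℂ (b q.2) (f q.1) * inner ℂ (star (g q.1)) (K (b q.2)) := by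
  let u : ℕ → L2 μ := fun i => ContinuousLinearMap.adjoint K (star (g i))
  have hu : Summable fun i => ‖u i‖ ^ 2 := by
    refine Summable.of_nonneg_of_le (fun i => by positivity) (fun i => ?_)
      (H.summable_right.mul_left (‖ContinuousLinearMap.adjoint K‖ ^ 2))
    rw [← mul_pow, ← norm_star_L2 (g i)]
    gcongr
    exact ContinuousLinearMap.le_opNorm _ _
  have aux : ∀ v : ℕ → L2 μ, Summable (fun i => ‖v i‖ ^ 2) →
      Summable fun q : ℕ × ι => ‖inner ℂ (v q.1) (b q.2)‖ ^ 2 := by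
    intro v hv
    refine (summable_prod_of_nonneg (fun q => by positivity)).2 ⟨fun i => ?_, ?_⟩
    · exact (hasSum_norm_sq_inner b (v i)).summable
    · simpa only [(hasSum_norm_sq_inner b (v _)).tsum_eq] using hv
  refine Summable.of_norm_bounded ((aux f H.summable_left).add (aux u hu)) fun q => ?_
  rw [norm_mul, norm_inner_symm, ← ContinuousLinearMap.adjoint_inner_left]
  change ‖inner ℂ (f q.1) (b q.2)‖ * ‖inner ℂ (u q.1) (b q.2)‖ ≤ _
  nlinarith [sq_nonneg (‖inner ℂ (f q.1) (b q.2)‖ - ‖inner ℂ (u q.1) (b q.2)‖),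
    sq_nonneg ‖inner ℂ (f q.1) (b q.2)‖, sq_nonneg ‖inner ℂ (u q.1) (b q.2)‖]

theorem IsRep.tsum_inner_eq {μ : Measure X} [SigmaFinite μ] {f g : ℕ → L2 μ}
    {h : X × X →ₘ[μ.prod μ] ℂ} (H : IsRep μ f g h) (K : L2 μ →L[ℂ] L2 μ) {ι : Type*}
    (b : HilbertBasis ι ℂ (L2 μ)) :
    ∑' i, inner ℂ (star (g i)) (K (f i)) =
      ∑' j, ∫ p, h p * (conj ((b j : L2 μ) p.1) * (K (b j)) p.2) ∂(μ.prod μ) := by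
  have hs := H.summable_inner K b
  have e1 : ∀ i, inner ℂ (star (g i)) (K (f i)) =
      ∑' j, inner ℂ (b j) (f i) * inner ℂ (star (g i)) (K (b j)) := by
    intro i
    rw [← ContinuousLinearMap.adjoint_inner_left, ← b.tsum_inner_mul_inner]
    refine tsum_congr fun j => ?_
    rw [ContinuousLinearMap.adjoint_inner_left, mul_comm]
  simp only [e1]
  rw [← Summable.tsum_comm (f := fun i j =>
    inner ℂ (b j) (f i) * inner ℂ (star (g i)) (K (b j))) hs]
  exact tsum_congr fun j => (H.hasSum_inner_mul_inner (b j) (K (b j))).tsum_eq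

/-- The pairing may be computed through any representation of `h`. -/
theorem pairing_eq_tsum {μ : Measure X} [SigmaFinite μ] (K : L2 μ →L[ℂ] L2 μ)
    (h : traceSpace μ) {f g : ℕ → L2 μ} (H : IsRep μ f g h) :
    pairing μ K h = ∑' i, inner ℂ (star (g i)) (K (f i)) := by
  obtain ⟨w, b, -⟩ := exists_hilbertBasis ℂ (L2 μ)
  rw [H.tsum_inner_eq K b]
  exact h.2.choose_spec.choose_spec.tsum_inner_eq K b

/-- The weak* topology of `T(X)`, as the dual space of the compact operators on `L²(X)`:
the coarsest topology for which `h ↦ ⟨K, h⟩` is continuous for every compact `K`. -/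
noncomputable abbrev weakStar (μ : Measure X) [SigmaFinite μ] : TopologicalSpace (traceSpace μ) :=
  TopologicalSpace.induced
    (fun h (K : {K : L2 μ →L[ℂ] L2 μ // IsCompactOperator K}) => pairing μ K.1 h)
    Pi.topologicalSpace

/-- `φ` is a Schur multiplier: a measurable, essentially bounded function on `X × X` such that
`φ h` is (equivalent to) a member of `T(X)` for every `h` in `T(X)`. -/
structure IsSchurMultiplier (μ : Measure X) [SigmaFinite μ] (φ : X × X → ℂ) : Prop where
  measurable : Measurable φ
  essBounded : ∃ C : ℝ, ∀ᵐ p ∂(μ.prod μ), ‖φ p‖ ≤ C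
  mul_mem : ∀ h : X × X →ₘ[μ.prod μ] ℂ, h ∈ traceSpace μ →
    AEEqFun.mk φ measurable.aestronglyMeasurable * h ∈ traceSpace μ

/-- The product `φ h` in `T(X)` of a Schur multiplier `φ` and an element `h` of `T(X)`. -/
noncomputable def IsSchurMultiplier.mul {μ : Measure X} [SigmaFinite μ] {φ : X × X → ℂ}
    (hφ : IsSchurMultiplier μ φ) (h : traceSpace μ) : traceSpace μ :=
  ⟨AEEqFun.mk φ hφ.measurable.aestronglyMeasurable * h.1, hφ.mul_mem h.1 h.2⟩

/-- A subspace of `T(X)` is invariant if it is closed under multiplication by every Schur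
multiplier. -/
def IsSchurInvariant {μ : Measure X} [SigmaFinite μ] (S : Submodule ℂ (traceSpace μ)) : Prop :=
  ∀ (φ : X × X → ℂ) (hφ : IsSchurMultiplier μ φ), ∀ h ∈ S, hφ.mul h ∈ S

end SchurMult

/-! By the bipolar argument of `mem_closure_weakStar_iff`, it suffices that a compact `K`
annihilating `S ⊓ T` also annihilates every `h` lying in both closures. The engine is that, after a
cutoff, an element of `T(X)` is itself a Schur multiplier, so in a product of two such elements
either factor may act on the other.

Two facts make this usable. If `φ = ∑ a i ⊗ b i` with `∑ ‖a i‖ ^ 2` and `∑ ‖b i‖ ^ 2` essentially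
bounded, then `h ↦ φ h` is the adjoint of `K ↦ ∑ i, b i K a i`, which preserves compactness
(`IsSqMultiplier.exists_pairing_mul`); hence multiplication by `φ` is weak* continuous. And every
`h` is the limit, against each bounded `K`, of products `χ n * h` with indicators of rectangles on
which the coefficients of `h` are square-bounded, so that `χ n * h` is such a `φ` (`exists_cutoff`).

For `u` in `S` and `v` in `T`, cut off to multipliers, the product `u v` lies in `S ⊓ T` by
invariance, and `K` kills it. Letting first `v` and then `u` vary, weak* continuity shows that `K`
kills `ψ u` whenever the multiplier `ψ` belongs to the closure of `T` (`pairing_mul_eq_zero`), and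
symmetrically for `S`. With `ψ = χ n * h`, which is in both closures, the compact operator adjoint
to `ψ` kills `S + T`, hence everything by density; evaluated at `χ n` it gives `⟨K, χ n * h⟩ = 0`,
and `n → ∞` finishes. -/

namespace SchurMult

variable {X : Type*} [MeasurableSpace X]

/-! ### Multiplication operators and square-bounded sequences. -/

/-- Multiplication by an essentially bounded function, as an operator on `L²(X)`. -/
noncomputable def mulOp {μ : Measure X} (a : Lp ℂ ∞ μ) : L2 μ →L[ℂ] L2 μ :=
  (ContinuousLinearMap.mul ℂ ℂ).holderL μ ∞ 2 2 a

theorem coeFn_mulOp {μ : Measure X} (a : Lp ℂ ∞ μ) (f : L2 μ) :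
    mulOp a f =ᵐ[μ] fun s => a s * f s :=
  (ContinuousLinearMap.mul ℂ ℂ).coeFn_holder a f

/-- The `star` turns the inner product into the bilinear integral `∫ g η`, across which a
multiplication operator moves without conjugating its symbol. -/
theorem inner_star_mulOp {μ : Measure X} (b : Lp ℂ ∞ μ) (g η : L2 μ) :
    inner ℂ (star g) (mulOp b η) = inner ℂ (star (mulOp b g)) η := by
  rw [inner_star_left, inner_star_left]
  refine integral_congr_ae ?_
  filter_upwards [coeFn_mulOp b g, coeFn_mulOp b η] with t h1 h2
  rw [h1, h2]
  ring

theorem norm_inner_star_le {μ : Measure X} (K : L2 μ →L[ℂ] L2 μ) (f g : L2 μ) :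
    ‖inner ℂ (star g) (K f)‖ ≤ ‖K‖ * (‖f‖ * ‖g‖) := by
  refine (norm_inner_le_norm _ _).trans ?_
  rw [norm_star_L2]
  nlinarith [K.le_opNorm f, norm_nonneg g]

theorem norm_sq_eq_integral {μ : Measure X} (f : L2 μ) : ‖f‖ ^ 2 = ∫ s, ‖f s‖ ^ 2 ∂μ := by
  have h : (inner ℂ f f : ℂ) = ((∫ s, ‖f s‖ ^ 2 ∂μ : ℝ) : ℂ) := by
    rw [L2.inner_def, ← integral_complex_ofReal]
    refine integral_congr_ae (.of_forall fun s => ?_)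
    simp only [inner_self_eq_norm_sq_to_K]
    norm_cast
  rw [inner_self_eq_norm_sq_to_K] at h
  exact Complex.ofReal_injective (by simpa using h)

theorem integrable_norm_sq {μ : Measure X} (f : L2 μ) : Integrable (fun s => ‖f s‖ ^ 2) μ :=
  (memLp_two_iff_integrable_sq_norm (Lp.aestronglyMeasurable f)).1 (Lp.memLp f)

/-- The functions `∑ i ∈ F, ‖a i‖ ^ 2`, for finite `F`, are bounded by `C` almost everywhere. -/
def SqBounded (μ : Measure X) (a : ℕ → Lp ℂ ∞ μ) (C : ℝ) : Prop :=
  ∀ᵐ s ∂μ, ∀ F : Finset ℕ, ∑ i ∈ F, ‖a i s‖ ^ 2 ≤ C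

theorem SqBounded.mono {μ : Measure X} {a : ℕ → Lp ℂ ∞ μ} {C D : ℝ} (ha : SqBounded μ a C)
    (h : C ≤ D) : SqBounded μ a D :=
  Filter.Eventually.mono ha fun _ hs F => (hs F).trans h

theorem SqBounded.sum_norm_sq_le {μ : Measure X} {a : ℕ → Lp ℂ ∞ μ} {C : ℝ}
    (ha : SqBounded μ a C) (f : L2 μ) (F : Finset ℕ) :
    ∑ i ∈ F, ‖mulOp (a i) f‖ ^ 2 ≤ C * ‖f‖ ^ 2 := by
  simp only [norm_sq_eq_integral]
  rw [← integral_finsetSum _ fun i _ => integrable_norm_sq _, ← integral_const_mul]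
  refine integral_mono_ae (integrable_finsetSum _ fun i _ => integrable_norm_sq _)
    ((integrable_norm_sq f).const_mul C) ?_
  have h : ∀ᵐ s ∂μ, ∀ i, mulOp (a i) f s = a i s * f s :=
    ae_all_iff.2 fun i => coeFn_mulOp (a i) f
  filter_upwards [ha, h] with s h1 h2
  simp only [h2, norm_mul, mul_pow, ← Finset.sum_mul]
  exact mul_le_mul_of_nonneg_right (h1 F) (by positivity)

theorem SqBounded.summable {μ : Measure X} {a : ℕ → Lp ℂ ∞ μ} {C : ℝ}
    (ha : SqBounded μ a C) (f : L2 μ) : Summable fun i => ‖mulOp (a i) f‖ ^ 2 :=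
  summable_of_sum_le (fun _ => by positivity) (ha.sum_norm_sq_le f)

theorem SqBounded.tsum_le {μ : Measure X} {a : ℕ → Lp ℂ ∞ μ} {C : ℝ}
    (ha : SqBounded μ a C) (f : L2 μ) : ∑' i, ‖mulOp (a i) f‖ ^ 2 ≤ C * ‖f‖ ^ 2 :=
  (ha.summable f).tsum_le_of_sum_le (ha.sum_norm_sq_le f)

theorem SqBounded.summable_prod {μ : Measure X} {a : ℕ → Lp ℂ ∞ μ} {C : ℝ}
    (ha : SqBounded μ a C) {f : ℕ → L2 μ} (hf : Summable fun j => ‖f j‖ ^ 2) :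
    Summable fun q : ℕ × ℕ => ‖mulOp (a q.1) (f q.2)‖ ^ 2 := by
  -- Swapping the indices puts the sum over the multiplier index inside, where it is at most `C * ‖f
  -- j‖ ^ 2`.
  refine ((Equiv.prodComm ℕ ℕ).summable_iff (f := fun q : ℕ × ℕ => _)).1 ?_
  refine (summable_prod_of_nonneg fun q => ?_).2 ⟨fun j => ha.summable (f j), ?_⟩
  · simp only [Pi.zero_apply, Function.comp_apply]; positivity
  · exact Summable.of_nonneg_of_le (fun j => tsum_nonneg fun i => sq_nonneg _)
      (fun j => ha.tsum_le (f j)) (hf.mul_left C)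

/-- Cauchy–Schwarz over `i` for the sesquilinear form of the operator. The bound is uniform in `F`,
so norm approximation of `K` controls all partial sums at once. -/
theorem norm_sum_mulOp_comp_le {μ : Measure X} {a b : ℕ → Lp ℂ ∞ μ} {C : ℝ} (hC : 0 ≤ C)
    (ha : SqBounded μ a C) (hb : SqBounded μ b C) (K : L2 μ →L[ℂ] L2 μ) (F : Finset ℕ) :
    ‖∑ i ∈ F, mulOp (b i) ∘L K ∘L mulOp (a i)‖ ≤ C * ‖K‖ := by
  refine ContinuousLinearMap.opNorm_le_of_re_inner_le (by positivity) fun x y => ?_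
  intro hx hy
  obtain ⟨y, rfl⟩ : ∃ z, y = star z := ⟨star y, (star_star y).symm⟩
  rw [norm_star_L2] at hy
  have hsum := (Real.sum_mul_le_sqrt_mul_sqrt F (fun i => ‖mulOp (a i) x‖)
    fun i => ‖mulOp (b i) y‖).trans (mul_le_mul (Real.sqrt_le_sqrt (ha.sum_norm_sq_le x F))
      (Real.sqrt_le_sqrt (hb.sum_norm_sq_le y F)) (Real.sqrt_nonneg _) (Real.sqrt_nonneg _))
  calc _ ≤ ‖inner ℂ ((∑ i ∈ F, mulOp (b i) ∘L K ∘L mulOp (a i)) x) (star y)‖ :=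
        RCLike.re_le_norm _
    _ = ‖∑ i ∈ F, inner ℂ (star (mulOp (b i) y)) (K (mulOp (a i) x))‖ := by
        rw [norm_inner_symm, sum_apply, inner_sum]
        simp only [ContinuousLinearMap.comp_apply, inner_star_mulOp]
    _ ≤ ∑ i ∈ F, ‖K‖ * (‖mulOp (a i) x‖ * ‖mulOp (b i) y‖) :=
        norm_sum_le_of_le _ fun i _ => norm_inner_star_le _ _ _
    _ = ‖K‖ * ∑ i ∈ F, ‖mulOp (a i) x‖ * ‖mulOp (b i) y‖ := (Finset.mul_sum _ _ _).symm
    _ ≤ ‖K‖ * (√(C * ‖x‖ ^ 2) * √(C * ‖y‖ ^ 2)) := mul_le_mul_of_nonneg_left hsum (norm_nonneg K)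
    _ = C * ‖K‖ := by
        rw [hx, hy, one_pow, mul_one, Real.mul_self_sqrt hC, mul_comm]

/-! ### The operation `K ↦ ∑ i, b i K a i` on compact operators. -/

/-- A compact operator into a Hilbert space is approximated in norm by its compressions to
finite-dimensional subspaces of the target. -/
theorem exists_norm_sub_starProjection_comp_le {E H : Type*} [NormedAddCommGroup E]
    [NormedSpace ℂ E] [NormedAddCommGroup H] [InnerProductSpace ℂ H] {K : E →L[ℂ] H}
    (hK : IsCompactOperator K) {ε : ℝ} (hε : 0 < ε) :
    ∃ (V : Submodule ℂ H) (_ : FiniteDimensional ℂ V), ‖K - V.starProjection ∘L K‖ ≤ ε := by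
  have hc := hK.isCompact_closure_image_closedBall (f := (K : E →ₗ[ℂ] H)) 1
  obtain ⟨t, -, htf, ht⟩ := hc.finite_cover_balls hε
  refine ⟨Submodule.span ℂ t, FiniteDimensional.span_of_finite ℂ htf, ?_⟩
  have := FiniteDimensional.span_of_finite ℂ htf
  refine ContinuousLinearMap.opNorm_le_of_unit_norm hε.le fun x hx => ?_
  have hx' : K x ∈ closure ((K : E →ₗ[ℂ] H) '' Metric.closedBall 0 1) :=
    subset_closure ⟨x, by simp [hx], rfl⟩
  obtain ⟨y, hy, hxy⟩ := Set.mem_iUnion₂.1 (ht hx')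
  refine le_trans ?_ (mem_ball_iff_norm.1 hxy).le
  -- The projection of `K x` is its nearest point in the span of the finite `ε`-net, so it does no
  -- worse than the net point `y`.
  rw [sub_apply, ContinuousLinearMap.comp_apply,
    Submodule.starProjection_minimal]
  exact ciInf_le ⟨0, by rintro _ ⟨v, rfl⟩; positivity⟩
    (⟨y, Submodule.subset_span hy⟩ : Submodule.span ℂ t)

/-- If `K` is compact, `∑ i, b i ∘ K ∘ a i` converges in norm as soon as `∑ ‖a i‖ ^ 2` and
`∑ ‖b i‖ ^ 2` are bounded functions. -/
theorem summable_mulOp_comp {μ : Measure X} {a b : ℕ → Lp ℂ ∞ μ} {C : ℝ}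
    (ha : SqBounded μ a C) (hb : SqBounded μ b C) {K : L2 μ →L[ℂ] L2 μ}
    (hK : IsCompactOperator K) : Summable fun i => mulOp (b i) ∘L K ∘L mulOp (a i) := by
  wlog hC : 0 ≤ C generalizing C
  · exact this (ha.mono (le_max_left C 0)) (hb.mono (le_max_left C 0)) (le_max_right _ _)
  -- For a rank one operator the `i`-th term has norm `‖b i x‖ * ‖a i y‖`, a product of square
  -- summable sequences; finite rank operators then follow by linearity.
  have hrank : ∀ x y : L2 μ, Summable fun i =>
      mulOp (b i) ∘L InnerProductSpace.rankOne ℂ x (star y) ∘L mulOp (a i) := by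
    intro x y
    have e : ∀ i, mulOp (b i) ∘L InnerProductSpace.rankOne ℂ x (star y) ∘L mulOp (a i) =
        InnerProductSpace.rankOne ℂ (mulOp (b i) x) (star (mulOp (a i) y)) := by
      intro i
      ext1 z
      simp [inner_star_mulOp]
    simp only [e]
    refine Summable.of_norm_bounded ((hb.summable x).add (ha.summable y)) fun i => ?_
    rw [InnerProductSpace.norm_rankOne, norm_star_L2]
    nlinarith [sq_nonneg (‖mulOp (b i) x‖ - ‖mulOp (a i) y‖), sq_nonneg ‖mulOp (b i) x‖,
      sq_nonneg ‖mulOp (a i) y‖]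
  have hfin : ∀ (V : Submodule ℂ (L2 μ)) [FiniteDimensional ℂ V], Summable fun i =>
      mulOp (b i) ∘L (V.starProjection ∘L K) ∘L mulOp (a i) := by
    intro V _
    have e := (stdOrthonormalBasis ℂ V).starProjection_eq_sum_rankOne
    have e' : V.starProjection ∘L K = ∑ k, InnerProductSpace.rankOne ℂ
        (stdOrthonormalBasis ℂ V k : L2 μ) (star (star
          (ContinuousLinearMap.adjoint K (stdOrthonormalBasis ℂ V k)))) := by
      rw [e]
      ext1 z
      simp [ContinuousLinearMap.adjoint_inner_left]
    rw [e']
    simp only [ContinuousLinearMap.finsetSum_comp, ContinuousLinearMap.comp_finsetSum]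
    exact summable_sum fun k _ => hrank _ _
  rw [summable_iff_vanishing_norm]
  intro ε hε
  -- The remainder contributes at most `C` times its norm to any partial sum, hence at most `ε / 2`;
  -- `C + 1` avoids dividing by zero when `C = 0`.
  obtain ⟨V, hV, hle⟩ := exists_norm_sub_starProjection_comp_le hK
    (show 0 < ε / (2 * (C + 1)) by positivity)
  obtain ⟨s, hs⟩ := summable_iff_vanishing_norm.1 (hfin V) (ε / 2) (by positivity)
  refine ⟨s, fun t ht => ?_⟩
  have e : ∑ i ∈ t, mulOp (b i) ∘L K ∘L mulOp (a i) =
      ∑ i ∈ t, mulOp (b i) ∘L (K - V.starProjection ∘L K) ∘L mulOp (a i) +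
      ∑ i ∈ t, mulOp (b i) ∘L (V.starProjection ∘L K) ∘L mulOp (a i) := by
    rw [← Finset.sum_add_distrib]
    refine Finset.sum_congr rfl fun i _ => ?_
    ext1 z
    simp
  have h1 := norm_sum_mulOp_comp_le hC ha hb (K - V.starProjection ∘L K) t
  have h2 : C * ‖K - V.starProjection ∘L K‖ ≤ ε / 2 := by
    calc _ ≤ (C + 1) * (ε / (2 * (C + 1))) := by gcongr; linarith
      _ = ε / 2 := by field_simp
  rw [e]
  exact (norm_add_le _ _).trans_lt (by linarith [hs t ht])

theorem isCompactOperator_tsum_mulOp_comp {μ : Measure X} {a b : ℕ → Lp ℂ ∞ μ} {C : ℝ}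
    (ha : SqBounded μ a C) (hb : SqBounded μ b C) {K : L2 μ →L[ℂ] L2 μ}
    (hK : IsCompactOperator K) :
    IsCompactOperator (∑' i, mulOp (b i) ∘L K ∘L mulOp (a i) : L2 μ →L[ℂ] L2 μ) := by
  refine isClosed_setOfPred_isCompactOperator.mem_of_tendsto (summable_mulOp_comp ha hb hK).hasSum
    (.of_forall fun F => ?_)
  refine Submodule.sum_mem (compactOperator (RingHom.id ℂ) (L2 μ) (L2 μ)) fun i _ => ?_
  exact (hK.comp_clm (mulOp (a i))).clm_comp (mulOp (b i))

/-! ### Reindexed representations and bilinearity of the pairing. -/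

theorem IsRep.of_equiv {μ : Measure X} {ι : Type*} (e : ℕ ≃ ι) {F G : ι → L2 μ}
    {h : X × X →ₘ[μ.prod μ] ℂ} (hF : Summable fun x => ‖F x‖ ^ 2)
    (hG : Summable fun x => ‖G x‖ ^ 2)
    (H : ∀ᵐ p ∂(μ.prod μ), HasSum (fun x => F x p.1 * G x p.2) (h p)) :
    IsRep μ (fun n => F (e n)) (fun n => G (e n)) h where
  summable_left := (e.summable_iff (f := fun x => ‖F x‖ ^ 2)).2 hF
  summable_right := (e.summable_iff (f := fun x => ‖G x‖ ^ 2)).2 hG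
  hasSum := H.mono fun p hp => (e.hasSum_iff (f := fun x => F x p.1 * G x p.2)).2 hp

theorem IsRep.summable_norm_mul_norm {μ : Measure X} {f g : ℕ → L2 μ}
    {h : X × X →ₘ[μ.prod μ] ℂ} (H : IsRep μ f g h) : Summable fun i => ‖f i‖ * ‖g i‖ :=
  Summable.of_nonneg_of_le (fun i => by positivity)
    (fun i => by nlinarith [sq_nonneg (‖f i‖ - ‖g i‖), sq_nonneg ‖f i‖, sq_nonneg ‖g i‖])
    (H.summable_left.add H.summable_right)

theorem IsRep.hasSum_pairing {μ : Measure X} [SigmaFinite μ] {f g : ℕ → L2 μ}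
    {h : traceSpace μ} (H : IsRep μ f g h) (K : L2 μ →L[ℂ] L2 μ) :
    HasSum (fun i => inner ℂ (star (g i)) (K (f i))) (pairing μ K h) := by
  rw [pairing_eq_tsum K h H]
  exact (Summable.of_norm_bounded (H.summable_norm_mul_norm.mul_left ‖K‖)
    fun i => norm_inner_star_le K _ _).hasSum

/-- Sums in `T(X)` are naturally indexed by `ℕ ⊕ ℕ` and products with multipliers by `ℕ × ℕ`; this
evaluates the pairing on them directly. -/
theorem hasSum_pairing_of_equiv {μ : Measure X} [SigmaFinite μ] {ι : Type*} (e : ℕ ≃ ι)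
    {F G : ι → L2 μ} {h : traceSpace μ} (hF : Summable fun x => ‖F x‖ ^ 2)
    (hG : Summable fun x => ‖G x‖ ^ 2)
    (H : ∀ᵐ p ∂(μ.prod μ), HasSum (fun x => F x p.1 * G x p.2) (h.1 p))
    (K : L2 μ →L[ℂ] L2 μ) :
    HasSum (fun x => inner ℂ (star (G x)) (K (F x))) (pairing μ K h) :=
  (e.hasSum_iff (f := fun x => inner ℂ (star (G x)) (K (F x)))).1
    ((IsRep.of_equiv e hF hG H).hasSum_pairing K)

theorem pairing_add_right {μ : Measure X} [SigmaFinite μ] (K : L2 μ →L[ℂ] L2 μ)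
    (h h' : traceSpace μ) : pairing μ K (h + h') = pairing μ K h + pairing μ K h' := by
  obtain ⟨f, g, H⟩ := h.2
  obtain ⟨f', g', H'⟩ := h'.2
  have hF : Summable fun x => ‖Sum.elim f f' x‖ ^ 2 :=
    (HasSum.sum (f := fun x => ‖Sum.elim f f' x‖ ^ 2)
      H.summable_left.hasSum H'.summable_left.hasSum).summable
  have hG : Summable fun x => ‖Sum.elim g g' x‖ ^ 2 :=
    (HasSum.sum (f := fun x => ‖Sum.elim g g' x‖ ^ 2)
      H.summable_right.hasSum H'.summable_right.hasSum).summable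
  have hs : ∀ᵐ p ∂(μ.prod μ), HasSum
      (fun x => (Sum.elim f f' x : L2 μ) p.1 * (Sum.elim g g' x : L2 μ) p.2) ((h + h').1 p) := by
    filter_upwards [AEEqFun.coeFn_add h.1 h'.1, H.hasSum, H'.hasSum] with p hp hh hh'
    rw [Submodule.coe_add, hp]
    exact HasSum.sum
      (f := fun x => (Sum.elim f f' x : L2 μ) p.1 * (Sum.elim g g' x : L2 μ) p.2) hh hh'
  refine (hasSum_pairing_of_equiv Equiv.natSumNatEquivNat.symm hF hG hs K).unique ?_
  exact HasSum.sum
    (f := fun x => inner ℂ (star (Sum.elim g g' x : L2 μ)) (K (Sum.elim f f' x)))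
    (H.hasSum_pairing K) (H'.hasSum_pairing K)

theorem pairing_smul_right {μ : Measure X} [SigmaFinite μ] (K : L2 μ →L[ℂ] L2 μ) (c : ℂ)
    (h : traceSpace μ) : pairing μ K (c • h) = c * pairing μ K h := by
  obtain ⟨f, g, H⟩ := h.2
  refine (IsRep.hasSum_pairing (h := c • h) (H.smul c) K).unique ?_
  simpa [inner_smul_right] using (H.hasSum_pairing K).mul_left c

theorem pairing_add_left {μ : Measure X} [SigmaFinite μ] (K L : L2 μ →L[ℂ] L2 μ)
    (h : traceSpace μ) : pairing μ (K + L) h = pairing μ K h + pairing μ L h := by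
  obtain ⟨f, g, H⟩ := h.2
  refine (H.hasSum_pairing (K + L)).unique ?_
  simpa [inner_add_right] using (H.hasSum_pairing K).add (H.hasSum_pairing L)

theorem pairing_smul_left {μ : Measure X} [SigmaFinite μ] (c : ℂ) (K : L2 μ →L[ℂ] L2 μ)
    (h : traceSpace μ) : pairing μ (c • K) h = c * pairing μ K h := by
  obtain ⟨f, g, H⟩ := h.2
  refine (H.hasSum_pairing (c • K)).unique ?_
  simpa [inner_smul_right] using (H.hasSum_pairing K).mul_left c

/-- The pairing as a bilinear map. -/
noncomputable def pairingBilin (μ : Measure X) [SigmaFinite μ] :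
    (L2 μ →L[ℂ] L2 μ) →ₗ[ℂ] traceSpace μ →ₗ[ℂ] ℂ :=
  LinearMap.mk₂ ℂ (pairing μ) pairing_add_left pairing_smul_left pairing_add_right
    fun c K h => pairing_smul_right K c h

/-! ### Weak* closures as annihilators. -/

/-- The weak* closure of a linear subspace `S` of `T(X)` is the annihilator of the compact operators
that annihilate `S`. -/
theorem mem_closure_weakStar_iff {μ : Measure X} [SigmaFinite μ]
    {S : Submodule ℂ (traceSpace μ)} {h : traceSpace μ} :
    h ∈ closure[weakStar μ] (S : Set (traceSpace μ)) ↔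
      ∀ K : L2 μ →L[ℂ] L2 μ, IsCompactOperator K → (∀ u ∈ S, pairing μ K u = 0) →
        pairing μ K h = 0 := by
  constructor
  · intro hh K hK hS
    let _ := weakStar μ
    have hcont : Continuous fun u : traceSpace μ => pairing μ K u :=
      (continuous_apply (A := fun _ => ℂ)
        (⟨K, hK⟩ : {K : L2 μ →L[ℂ] L2 μ // IsCompactOperator K})).comp
        (continuous_induced_dom (f := fun (u : traceSpace μ)
          (K : {K : L2 μ →L[ℂ] L2 μ // IsCompactOperator K}) => pairing μ K.1 u))
    exact closure_minimal (t := {u | pairing μ K u = 0}) hS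
      (isClosed_eq hcont continuous_const) hh
  · classical
    intro H
    rw [closure_induced, mem_closure_iff_nhds]
    intro U hU
    rw [nhds_pi, Filter.mem_pi] at hU
    obtain ⟨I, hI, t, ht, hsub⟩ := hU
    have := hI.fintype
    -- A basic neighbourhood involves finitely many operators, so separation takes place in `I → ℂ`:
    -- the coefficients of a functional killing `Q S` but not `Q h` combine these operators into a
    -- compact `K` contradicting `H`.
    let Q : traceSpace μ →ₗ[ℂ] (I → ℂ) := LinearMap.pi fun i => pairingBilin μ i.1.1
    have hQ : Q h ∈ S.map Q := by
      by_contra hn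
      obtain ⟨c, hc, hle⟩ := Submodule.exists_le_ker_of_notMem hn
      let K : L2 μ →L[ℂ] L2 μ := ∑ i : I, c (Pi.single i 1) • i.1.1
      have hK : IsCompactOperator K := by
        refine Submodule.sum_mem (compactOperator (RingHom.id ℂ) (L2 μ) (L2 μ)) fun i _ => ?_
        exact Submodule.smul_mem _ _ i.1.2
      have hKc : ∀ u, pairing μ K u = c (Q u) := by
        intro u
        change pairingBilin μ K u = _
        rw [LinearMap.pi_apply_eq_sum_univ c (Q u)]
        simp only [K, map_sum, map_smul, LinearMap.sum_apply, LinearMap.smul_apply, smul_eq_mul]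
        refine Finset.sum_congr rfl fun i _ => ?_
        rw [mul_comm]
        congr 2
        ext j
        simp [Pi.single_apply, eq_comm]
      refine hc ?_
      rw [← hKc]
      refine H K hK fun u hu => ?_
      rw [hKc]
      exact hle (Submodule.mem_map_of_mem hu)
    obtain ⟨u, hu, hue⟩ := hQ
    refine ⟨_, hsub fun i hi => ?_, ⟨u, hu, rfl⟩⟩
    have : pairing μ i.1 u = pairing μ i.1 h := congrFun hue ⟨i, hi⟩
    change pairing μ i.1 u ∈ t i
    rw [this]
    exact mem_of_mem_nhds (ht i)

/-! ### Square-bounded multipliers and their adjoints. -/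

/-- A function on `X × X` of the form `∑ i, a i s * b i t`, where `∑ i, ‖a i‖ ^ 2` and
`∑ i, ‖b i‖ ^ 2` are essentially bounded. -/
structure IsSqMultiplier (μ : Measure X) (φ : X × X → ℂ) : Prop where
  measurable : Measurable φ
  exists_rep : ∃ (a b : ℕ → Lp ℂ ∞ μ) (C : ℝ), SqBounded μ a C ∧ SqBounded μ b C ∧
    ∀ᵐ p ∂(μ.prod μ), HasSum (fun i => a i p.1 * b i p.2) (φ p)

theorem hasSum_mul_prod {ι κ : Type*} {u : ι → ℂ} {v : κ → ℂ} {x y : ℂ}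
    (hu : HasSum u x) (hv : HasSum v y) : HasSum (fun q : ι × κ => u q.1 * v q.2) (x * y) :=
  hu.mul hv (summable_mul_of_summable_norm hu.summable.norm hv.summable.norm)

theorem IsRep.ae_hasSum_mul {μ : Measure X} [SigmaFinite μ] {φ : X × X → ℂ}
    (hφ : Measurable φ) {a b : ℕ → Lp ℂ ∞ μ}
    (hab : ∀ᵐ p ∂(μ.prod μ), HasSum (fun i => a i p.1 * b i p.2) (φ p))
    {f g : ℕ → L2 μ} {h : X × X →ₘ[μ.prod μ] ℂ} (H : IsRep μ f g h) :
    ∀ᵐ p ∂(μ.prod μ), HasSum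
      (fun q : ℕ × ℕ => mulOp (a q.1) (f q.2) p.1 * mulOp (b q.1) (g q.2) p.2)
      ((AEEqFun.mk φ hφ.aestronglyMeasurable * h : X × X →ₘ[μ.prod μ] ℂ) p) := by
  have h1 : ∀ᵐ p ∂(μ.prod μ), ∀ q : ℕ × ℕ, mulOp (a q.1) (f q.2) p.1 = a q.1 p.1 * f q.2 p.1 :=
    ae_all_iff.2 fun q => Measure.quasiMeasurePreserving_fst.ae (coeFn_mulOp _ _)
  have h2 : ∀ᵐ p ∂(μ.prod μ), ∀ q : ℕ × ℕ, mulOp (b q.1) (g q.2) p.2 = b q.1 p.2 * g q.2 p.2 :=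
    ae_all_iff.2 fun q => Measure.quasiMeasurePreserving_snd.ae (coeFn_mulOp _ _)
  filter_upwards [h1, h2, hab, H.hasSum,
    AEEqFun.coeFn_mul (AEEqFun.mk φ hφ.aestronglyMeasurable) h,
    AEEqFun.coeFn_mk φ hφ.aestronglyMeasurable] with p h1 h2 h3 h4 h5 h6
  rw [h5, Pi.mul_apply, h6]
  have e : (fun q : ℕ × ℕ => mulOp (a q.1) (f q.2) p.1 * mulOp (b q.1) (g q.2) p.2) =
      fun q => (a q.1 p.1 * b q.1 p.2) * (f q.2 p.1 * g q.2 p.2) :=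
    funext fun q => by rw [h1, h2, mul_mul_mul_comm]
  have hmul := hasSum_mul_prod h3 h4
  rwa [← e] at hmul

theorem IsSqMultiplier.essBounded {μ : Measure X} [SigmaFinite μ] {φ : X × X → ℂ}
    (hφ : IsSqMultiplier μ φ) : ∃ C : ℝ, ∀ᵐ p ∂(μ.prod μ), ‖φ p‖ ≤ C := by
  obtain ⟨a, b, C, ha, hb, hab⟩ := hφ.exists_rep
  refine ⟨C, ?_⟩
  filter_upwards [Measure.quasiMeasurePreserving_fst.ae ha,
    Measure.quasiMeasurePreserving_snd.ae hb, hab] with p h1 h2 h3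
  refine le_of_tendsto h3.norm (.of_forall fun F => ?_)
  calc ‖∑ i ∈ F, a i p.1 * b i p.2‖ ≤ ∑ i ∈ F, (‖a i p.1‖ ^ 2 + ‖b i p.2‖ ^ 2) / 2 := by
        refine norm_sum_le_of_le _ fun i _ => ?_
        rw [norm_mul]
        nlinarith [sq_nonneg (‖a i p.1‖ - ‖b i p.2‖)]
    _ ≤ C := by
        rw [← Finset.sum_div, Finset.sum_add_distrib]
        linarith [h1 F, h2 F]

theorem IsSqMultiplier.isSchurMultiplier {μ : Measure X} [SigmaFinite μ] {φ : X × X → ℂ}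
    (hφ : IsSqMultiplier μ φ) : IsSchurMultiplier μ φ where
  measurable := hφ.measurable
  essBounded := hφ.essBounded
  mul_mem := by
    rintro h ⟨f, g, H⟩
    obtain ⟨a, b, C, ha, hb, hab⟩ := hφ.exists_rep
    exact ⟨_, _, IsRep.of_equiv Nat.pairEquiv.symm (ha.summable_prod H.summable_left)
      (hb.summable_prod H.summable_right) (H.ae_hasSum_mul hφ.measurable hab)⟩

/-- Schur multiplication by `φ` is the adjoint of an operation on compact operators. -/
theorem IsSqMultiplier.exists_pairing_mul {μ : Measure X} [SigmaFinite μ] {φ : X × X → ℂ}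
    (hφ : IsSqMultiplier μ φ) {K : L2 μ →L[ℂ] L2 μ} (hK : IsCompactOperator K) :
    ∃ L : L2 μ →L[ℂ] L2 μ, IsCompactOperator L ∧
      ∀ h, pairing μ K (hφ.isSchurMultiplier.mul h) = pairing μ L h := by
  obtain ⟨a, b, C, ha, hb, hab⟩ := hφ.exists_rep
  have hs := summable_mulOp_comp ha hb hK
  refine ⟨_, isCompactOperator_tsum_mulOp_comp ha hb hK, fun h => ?_⟩
  obtain ⟨f, g, H⟩ := h.2
  have h1 := hasSum_pairing_of_equiv (h := hφ.isSchurMultiplier.mul h) Nat.pairEquiv.symm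
    (ha.summable_prod H.summable_left)
    (hb.summable_prod H.summable_right) (H.ae_hasSum_mul hφ.measurable hab) K
  -- With the representation index `j` outermost, the inner sum over `i` is the matrix coefficient
  -- of `∑ i, b i K a i` at `f j` and `star (g j)`.
  have h2 := (Equiv.prodComm ℕ ℕ).hasSum_iff.2 h1
  refine (h2.prod_fiberwise (g := fun j => inner ℂ (star (g j))
    ((∑' i, mulOp (b i) ∘L K ∘L mulOp (a i) : L2 μ →L[ℂ] L2 μ) (f j))) fun j => ?_).unique
      (H.hasSum_pairing _)
  have h3 := ((innerSL ℂ (star (g j))).comp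
    (ContinuousLinearMap.apply ℂ (L2 μ) (f j))).hasSum hs.hasSum
  simpa [inner_star_mulOp] using h3

/-! ### Indicators of sets and rectangles. -/

/-- The indicator function of a measurable set, as an element of `L^∞`. -/
noncomputable def indLp (μ : Measure X) {A : Set X} (hA : MeasurableSet A) : Lp ℂ ∞ μ :=
  MemLp.toLp (A.indicator 1) ((memLp_top_const (1 : ℂ)).indicator hA)

theorem coeFn_indLp {μ : Measure X} {A : Set X} (hA : MeasurableSet A) :
    indLp μ hA =ᵐ[μ] A.indicator 1 :=
  MemLp.coeFn_toLp _

theorem coeFn_mulOp_indLp {μ : Measure X} {A : Set X} (hA : MeasurableSet A) (f : L2 μ) :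
    mulOp (indLp μ hA) f =ᵐ[μ] A.indicator f := by
  filter_upwards [coeFn_mulOp (indLp μ hA) f, coeFn_indLp (μ := μ) hA] with s h1 h2
  rw [h1, h2]
  by_cases hs : s ∈ A <;> simp [hs]

theorem norm_mulOp_indLp_le {μ : Measure X} {A : Set X} (hA : MeasurableSet A) (f : L2 μ) :
    ‖mulOp (indLp μ hA) f‖ ≤ ‖f‖ := by
  refine Lp.norm_le_norm_of_ae_le ?_
  filter_upwards [coeFn_mulOp_indLp hA f] with s hs
  rw [hs]
  exact norm_indicator_le_norm_self _ _

theorem tendsto_mulOp_indLp {μ : Measure X} {A : ℕ → Set X} (hA : ∀ n, MeasurableSet (A n))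
    (h : ∀ᵐ s ∂μ, ∀ᶠ n in Filter.atTop, s ∈ A n) (f : L2 μ) :
    Filter.Tendsto (fun n => mulOp (indLp μ (hA n)) f) Filter.atTop (𝓝 f) := by
  rw [tendsto_iff_norm_sub_tendsto_zero]
  suffices H : Filter.Tendsto (fun n => ‖mulOp (indLp μ (hA n)) f - f‖ ^ 2) Filter.atTop (𝓝 0) by
    simpa using H.sqrt
  simp only [norm_sq_eq_integral]
  have hae : ∀ᵐ s ∂μ, ∀ n, (mulOp (indLp μ (hA n)) f - f : L2 μ) s = (A n).indicator f s - f s := by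
    refine ae_all_iff.2 fun n => ?_
    filter_upwards [Lp.coeFn_sub (mulOp (indLp μ (hA n)) f) f, coeFn_mulOp_indLp (hA n) f]
      with s h1 h2
    rw [h1, Pi.sub_apply, h2]
  have := tendsto_integral_of_dominated_convergence (μ := μ)
    (F := fun n s => ‖(mulOp (indLp μ (hA n)) f - f : L2 μ) s‖ ^ 2) (f := fun _ => 0)
    (fun s => ‖f s‖ ^ 2) (fun n => (integrable_norm_sq _).1) (integrable_norm_sq f) ?_ ?_
  · simpa using this
  · intro n
    filter_upwards [hae] with s hs
    rw [hs n]
    by_cases hsn : s ∈ A n <;> simp [hsn]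
  · filter_upwards [hae, h] with s hs hs'
    refine tendsto_const_nhds.congr' ?_
    filter_upwards [hs'] with n hn
    rw [hs n, Set.indicator_of_mem hn, sub_self, norm_zero, zero_pow two_ne_zero]

/-- The indicator function of a rectangle. -/
noncomputable def rect {Y : Type*} (A B : Set Y) : Y × Y → ℂ := (A ×ˢ B).indicator 1

theorem rect_apply {Y : Type*} (A B : Set Y) (p : Y × Y) :
    rect A B p = A.indicator 1 p.1 * B.indicator 1 p.2 := by
  by_cases h1 : p.1 ∈ A <;> by_cases h2 : p.2 ∈ B <;> simp [rect, Set.mem_prod, h1, h2]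

theorem rect_mul_rect {Y : Type*} (A B : Set Y) : rect A B * rect A B = rect A B := by
  ext p
  by_cases h : p ∈ A ×ˢ B <;> simp [rect, h]

theorem measurable_rect {A B : Set X} (hA : MeasurableSet A) (hB : MeasurableSet B) :
    Measurable (rect A B) :=
  measurable_one.indicator (hA.prod hB)

theorem sqBounded_single_indLp {μ : Measure X} {A : Set X} (hA : MeasurableSet A) :
    SqBounded μ (Pi.single 0 (indLp μ hA)) 1 := by
  filter_upwards [coeFn_indLp (μ := μ) hA, Lp.coeFn_zero ℂ ∞ μ] with s hs h0 F
  have : ∀ i, i ≠ 0 → ‖(Pi.single 0 (indLp μ hA) : ℕ → Lp ℂ ∞ μ) i s‖ ^ 2 = 0 := by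
    intro i hi
    rw [Pi.single_eq_of_ne hi, h0, Pi.zero_apply, norm_zero, zero_pow two_ne_zero]
  -- Adjoining `0` to `F` removes the case distinction on whether `F` contains the only nonzero
  -- term.
  refine (Finset.sum_le_sum_of_subset_of_nonneg (Finset.subset_insert 0 F)
    fun i _ _ => by positivity).trans ?_
  rw [Finset.sum_eq_single_of_mem 0 (Finset.mem_insert_self _ _) fun i _ hi => this i hi]
  rw [Pi.single_eq_same, hs]
  by_cases hsA : s ∈ A <;> simp [hsA]

theorem isSqMultiplier_rect (μ : Measure X) [SigmaFinite μ] {A B : Set X} (hA : MeasurableSet A)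
    (hB : MeasurableSet B) : IsSqMultiplier μ (rect A B) where
  measurable := measurable_rect hA hB
  exists_rep := by
    refine ⟨_, _, 1, sqBounded_single_indLp hA, sqBounded_single_indLp hB, ?_⟩
    filter_upwards [Measure.quasiMeasurePreserving_fst.ae (coeFn_indLp (μ := μ) hA),
      Measure.quasiMeasurePreserving_snd.ae (coeFn_indLp (μ := μ) hB),
      Measure.quasiMeasurePreserving_fst.ae (Lp.coeFn_zero ℂ ∞ μ)] with p h1 h2 h3
    rw [rect_apply, ← h1, ← h2]
    refine hasSum_single (f := fun i => (Pi.single 0 (indLp μ hA) : ℕ → Lp ℂ ∞ μ) i p.1 *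
      (Pi.single 0 (indLp μ hB) : ℕ → Lp ℂ ∞ μ) i p.2) 0 fun i hi => ?_
    rw [Pi.single_eq_of_ne hi, h3, Pi.zero_apply, zero_mul]

theorem IsRep.rect_mul {μ : Measure X} [SigmaFinite μ] {A B : Set X} (hA : MeasurableSet A)
    (hB : MeasurableSet B) {f g : ℕ → L2 μ} {h : X × X →ₘ[μ.prod μ] ℂ} (H : IsRep μ f g h) :
    IsRep μ (fun i => mulOp (indLp μ hA) (f i)) (fun i => mulOp (indLp μ hB) (g i))
      (AEEqFun.mk (rect A B) (measurable_rect hA hB).aestronglyMeasurable * h) where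
  summable_left := H.summable_left.of_nonneg_of_le (fun _ => by positivity)
    fun i => pow_le_pow_left₀ (norm_nonneg _) (norm_mulOp_indLp_le hA _) 2
  summable_right := H.summable_right.of_nonneg_of_le (fun _ => by positivity)
    fun i => pow_le_pow_left₀ (norm_nonneg _) (norm_mulOp_indLp_le hB _) 2
  hasSum := by
    have h1 : ∀ᵐ p ∂(μ.prod μ), ∀ i, mulOp (indLp μ hA) (f i) p.1 = A.indicator (f i) p.1 :=
      ae_all_iff.2 fun i => Measure.quasiMeasurePreserving_fst.ae (coeFn_mulOp_indLp _ _)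
    have h2 : ∀ᵐ p ∂(μ.prod μ), ∀ i, mulOp (indLp μ hB) (g i) p.2 = B.indicator (g i) p.2 :=
      ae_all_iff.2 fun i => Measure.quasiMeasurePreserving_snd.ae (coeFn_mulOp_indLp _ _)
    filter_upwards [h1, h2, H.hasSum,
      AEEqFun.coeFn_mul (AEEqFun.mk (rect A B) (measurable_rect hA hB).aestronglyMeasurable) h,
      AEEqFun.coeFn_mk (rect A B) (measurable_rect hA hB).aestronglyMeasurable]
      with p h1 h2 h3 h4 h5
    rw [h4, Pi.mul_apply, h5, rect_apply]
    simp only [h1, h2]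
    convert! h3.mul_left _ using 2 with i
    by_cases hp : p.1 ∈ A <;> by_cases hq : p.2 ∈ B <;> simp [hp, hq]

/-! ### Cutting elements of `T(X)` down to multipliers. -/

/-- By Tonelli, `∑ i, ‖f i s‖ ^ 2` has finite integral `∑ i, ‖f i‖ ^ 2`, so it is finite almost
everywhere. Hence the sets `cutSet f n` exhaust `X` up to a null set. -/
theorem ae_exists_sum_norm_sq_le {μ : Measure X} {f : ℕ → L2 μ}
    (hf : Summable fun i => ‖f i‖ ^ 2) :
    ∀ᵐ s ∂μ, ∃ C : ℝ, ∀ F : Finset ℕ, ∑ i ∈ F, ‖f i s‖ ^ 2 ≤ C := by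
  have hm : ∀ i, AEMeasurable (fun s => ENNReal.ofReal (‖f i s‖ ^ 2)) μ := fun i =>
    (integrable_norm_sq (f i)).1.aemeasurable.ennreal_ofReal
  have h : ∫⁻ s, ∑' i, ENNReal.ofReal (‖f i s‖ ^ 2) ∂μ ≠ ∞ := by
    rw [lintegral_tsum hm]
    have e : ∀ i, ∫⁻ s, ENNReal.ofReal (‖f i s‖ ^ 2) ∂μ = ENNReal.ofReal (‖f i‖ ^ 2) := fun i => by
      rw [norm_sq_eq_integral, ofReal_integral_eq_lintegral_ofReal (integrable_norm_sq (f i))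
        (.of_forall fun s => by positivity)]
    simp only [e]
    rw [← ENNReal.ofReal_tsum_of_nonneg (fun i => by positivity) hf]
    exact ENNReal.ofReal_ne_top
  filter_upwards [ae_lt_top' (AEMeasurable.tsum hm) h] with s hs
  refine ⟨(∑' i, ENNReal.ofReal (‖f i s‖ ^ 2)).toReal, fun F => ?_⟩
  rw [← ENNReal.ofReal_le_iff_le_toReal hs.ne,
    ENNReal.ofReal_sum_of_nonneg fun i _ => by positivity]
  exact ENNReal.sum_le_tsum F

/-- The set where `∑ i, ‖f i‖ ^ 2` is at most `n`, intersected with a set of finite measure. -/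
def cutSet {μ : Measure X} [SigmaFinite μ] (f : ℕ → L2 μ) (n : ℕ) : Set X :=
  {s | ∀ F : Finset ℕ, ∑ i ∈ F, ‖f i s‖ ^ 2 ≤ n} ∩ spanningSets μ n

theorem measurableSet_cutSet {μ : Measure X} [SigmaFinite μ] (f : ℕ → L2 μ) (n : ℕ) :
    MeasurableSet (cutSet f n) := by
  refine MeasurableSet.inter ?_ (measurableSet_spanningSets μ n)
  rw [Set.ofPred_forall]
  refine MeasurableSet.iInter fun F => measurableSet_le ?_ measurable_const
  exact Finset.measurable_fun_sum F fun i _ =>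
    (Lp.stronglyMeasurable (f i)).measurable.norm.pow_const 2

theorem ae_eventually_mem_cutSet {μ : Measure X} [SigmaFinite μ] {f : ℕ → L2 μ}
    (hf : Summable fun i => ‖f i‖ ^ 2) : ∀ᵐ s ∂μ, ∀ᶠ n in Filter.atTop, s ∈ cutSet f n := by
  filter_upwards [ae_exists_sum_norm_sq_le hf] with s ⟨C, hC⟩
  obtain ⟨N, hN⟩ := exists_nat_ge C
  filter_upwards [Filter.eventually_ge_atTop N, eventually_mem_spanningSets μ s] with n hn hs
  exact ⟨fun F => (hC F).trans (hN.trans (by exact_mod_cast hn)), hs⟩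

theorem norm_indicator_cutSet_le {μ : Measure X} [SigmaFinite μ] (f : ℕ → L2 μ) (n i : ℕ) (s : X) :
    ‖(cutSet f n).indicator (f i) s‖ ≤ √n := by
  by_cases hs : s ∈ cutSet f n
  · rw [Set.indicator_of_mem hs]
    exact Real.le_sqrt_of_sq_le (by simpa using hs.1 {i})
  · simp [hs]

/-- The restriction of `f i` to `cutSet f n`. -/
noncomputable def cutLp {μ : Measure X} [SigmaFinite μ] (f : ℕ → L2 μ) (n i : ℕ) : Lp ℂ ∞ μ :=
  MemLp.toLp ((cutSet f n).indicator (f i)) (memLp_top_of_bound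
    ((Lp.aestronglyMeasurable (f i)).indicator (measurableSet_cutSet f n)) √n
    (.of_forall (norm_indicator_cutSet_le f n i)))

theorem coeFn_cutLp {μ : Measure X} [SigmaFinite μ] (f : ℕ → L2 μ) (n i : ℕ) :
    cutLp f n i =ᵐ[μ] (cutSet f n).indicator (f i) :=
  MemLp.coeFn_toLp _

theorem sqBounded_cutLp {μ : Measure X} [SigmaFinite μ] (f : ℕ → L2 μ) (n : ℕ) :
    SqBounded μ (cutLp f n) n := by
  filter_upwards [ae_all_iff.2 (coeFn_cutLp f n)] with s hs F
  simp only [hs]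
  by_cases h : s ∈ cutSet f n
  · simpa [h] using h.1 F
  · simp [h]

/-- On the rectangle both coefficient sequences have square sums at most `n`, so their restrictions
form a square-bounded representation. -/
theorem isSqMultiplier_rect_mul {μ : Measure X} [SigmaFinite μ] {f g : ℕ → L2 μ}
    {h : X × X →ₘ[μ.prod μ] ℂ} (H : IsRep μ f g h) (n : ℕ) :
    IsSqMultiplier μ (rect (cutSet f n) (cutSet g n) * h) where
  measurable := (measurable_rect (measurableSet_cutSet f n) (measurableSet_cutSet g n)).mul
    h.stronglyMeasurable.measurable
  exists_rep := by
    refine ⟨_, _, n, sqBounded_cutLp f n, sqBounded_cutLp g n, ?_⟩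
    filter_upwards [Measure.quasiMeasurePreserving_fst.ae (ae_all_iff.2 (coeFn_cutLp f n)),
      Measure.quasiMeasurePreserving_snd.ae (ae_all_iff.2 (coeFn_cutLp g n)), H.hasSum]
      with p h1 h2 h3
    simp only [h1, h2, Pi.mul_apply, rect_apply]
    have h4 := h3.mul_left
      ((cutSet f n).indicator 1 p.1 * (cutSet g n).indicator 1 p.2)
    have e : (fun i => (cutSet f n).indicator (f i) p.1 * (cutSet g n).indicator (g i) p.2) =
        fun i => (cutSet f n).indicator 1 p.1 * (cutSet g n).indicator 1 p.2 *
          (f i p.1 * g i p.2) := by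
      ext i
      by_cases hp : p.1 ∈ cutSet f n <;> by_cases hq : p.2 ∈ cutSet g n <;> simp [hp, hq]
    rwa [← e] at h4

theorem rect_mem_traceSpace {μ : Measure X} [SigmaFinite μ] {A B : Set X} (hA : MeasurableSet A)
    (hB : MeasurableSet B) (hA' : μ A ≠ ∞) (hB' : μ B ≠ ∞) :
    AEEqFun.mk (rect A B) (measurable_rect hA hB).aestronglyMeasurable ∈ traceSpace μ := by
  have hs : ∀ x : L2 μ, Summable fun i => ‖(Pi.single 0 x : ℕ → L2 μ) i‖ ^ 2 := fun x =>
    summable_of_ne_finset_zero (s := {0}) fun i hi => by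
      rw [Pi.single_eq_of_ne (by simpa using hi), norm_zero, zero_pow two_ne_zero]
  refine ⟨Pi.single 0 (indicatorConstLp 2 hA hA' 1), Pi.single 0 (indicatorConstLp 2 hB hB' 1),
    hs _, hs _, ?_⟩
  filter_upwards [AEEqFun.coeFn_mk (rect A B) (measurable_rect hA hB).aestronglyMeasurable,
    Measure.quasiMeasurePreserving_fst.ae (indicatorConstLp_coeFn (p := 2) (hs := hA)
      (hμs := hA') (c := (1 : ℂ))),
    Measure.quasiMeasurePreserving_snd.ae (indicatorConstLp_coeFn (p := 2) (hs := hB)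
      (hμs := hB') (c := (1 : ℂ))),
    Measure.quasiMeasurePreserving_fst.ae (Lp.coeFn_zero ℂ 2 μ)] with p h1 h2 h3 h4
  have e : rect A B p = indicatorConstLp 2 hA hA' (1 : ℂ) p.1 *
      indicatorConstLp 2 hB hB' (1 : ℂ) p.2 := by
    rw [h2, h3, rect_apply]
    rfl
  rw [h1, e]
  refine hasSum_single (f := fun i =>
    (Pi.single 0 (indicatorConstLp 2 hA hA' 1) : ℕ → L2 μ) i p.1 *
      (Pi.single 0 (indicatorConstLp 2 hB hB' 1) : ℕ → L2 μ) i p.2) 0 fun i hi => ?_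
  rw [Pi.single_eq_of_ne hi, h4, Pi.zero_apply, zero_mul]

theorem tendsto_star_L2 {μ : Measure X} {ι : Type*} {l : Filter ι} {f : ι → L2 μ} {x : L2 μ}
    (h : Filter.Tendsto f l (𝓝 x)) : Filter.Tendsto (fun n => star (f n)) l (𝓝 (star x)) := by
  rw [tendsto_iff_norm_sub_tendsto_zero] at h ⊢
  refine h.congr fun n => ?_
  rw [← norm_star_L2]
  congr 1
  refine Lp.ext ?_
  filter_upwards [Lp.coeFn_star (f n - x), Lp.coeFn_sub (star (f n)) (star x),
    Lp.coeFn_star (f n), Lp.coeFn_star x, Lp.coeFn_sub (f n) x] with s h1 h2 h3 h4 h5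
  rw [h1, h2, Pi.star_apply, h5, Pi.sub_apply, Pi.sub_apply, h3, h4, star_sub, Pi.star_apply,
    Pi.star_apply]

/-- Dominated convergence in the series: restriction is contractive, so `‖K‖ * (‖f i‖ * ‖g i‖)`
dominates, and each term converges because the restrictions converge in `L²`. -/
theorem tendsto_pairing_rect_mul {μ : Measure X} [SigmaFinite μ] {A B : ℕ → Set X}
    (hA : ∀ n, MeasurableSet (A n)) (hB : ∀ n, MeasurableSet (B n))
    (hA' : ∀ᵐ s ∂μ, ∀ᶠ n in Filter.atTop, s ∈ A n) (hB' : ∀ᵐ s ∂μ, ∀ᶠ n in Filter.atTop, s ∈ B n)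
    (h : traceSpace μ) (K : L2 μ →L[ℂ] L2 μ) :
    Filter.Tendsto
      (fun n => pairing μ K ((isSqMultiplier_rect μ (hA n) (hB n)).isSchurMultiplier.mul h))
      Filter.atTop (𝓝 (pairing μ K h)) := by
  obtain ⟨f, g, H⟩ := h.2
  have e : ∀ n, pairing μ K ((isSqMultiplier_rect μ (hA n) (hB n)).isSchurMultiplier.mul h) =
      ∑' i, inner ℂ (star (g i))
        ((mulOp (indLp μ (hB n))) (K (mulOp (indLp μ (hA n)) (f i)))) := fun n => by
    rw [pairing_eq_tsum K _ (H.rect_mul (hA n) (hB n))]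
    simp only [inner_star_mulOp]
  simp only [e]
  rw [pairing_eq_tsum K h H]
  refine tendsto_tsum_of_dominated_convergence (H.summable_norm_mul_norm.mul_left ‖K‖)
    (fun i => ?_) (.of_forall fun n i => ?_)
  · have h1 : Filter.Tendsto (fun n => inner ℂ (star (mulOp (indLp μ (hB n)) (g i)))
        (K (mulOp (indLp μ (hA n)) (f i)))) Filter.atTop (𝓝 (inner ℂ (star (g i)) (K (f i)))) :=
      (tendsto_star_L2 (tendsto_mulOp_indLp hB hB' (g i))).inner
        ((K.continuous.tendsto _).comp (tendsto_mulOp_indLp hA hA' (f i)))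
    simpa only [inner_star_mulOp] using h1
  · rw [inner_star_mulOp]
    refine (norm_inner_star_le _ _ _).trans ?_
    have h1 := norm_mulOp_indLp_le (hA n) (f i)
    have h2 := norm_mulOp_indLp_le (hB n) (g i)
    gcongr

theorem IsSchurMultiplier.coe_mul {μ : Measure X} [SigmaFinite μ] {φ : X × X → ℂ}
    (hφ : IsSchurMultiplier μ φ) (h : traceSpace μ) :
    (hφ.mul h : X × X →ₘ[μ.prod μ] ℂ) = AEEqFun.mk φ hφ.measurable.aestronglyMeasurable * h.1 :=
  rfl

/-- Every `h` in `T(X)` is a limit of products `χ n * h`, where `χ n` is (the indicator function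
of a rectangle) in `T(X)` and `χ n * h` is a multiplier. -/
theorem exists_cutoff {μ : Measure X} [SigmaFinite μ] (h : traceSpace μ) :
    ∃ (χ ψ : ℕ → X × X → ℂ) (hχ : ∀ n, IsSqMultiplier μ (χ n)) (hψ : ∀ n, IsSqMultiplier μ (ψ n)),
      (∀ n, ((hχ n).isSchurMultiplier.mul h : X × X →ₘ[μ.prod μ] ℂ) =
        AEEqFun.mk (ψ n) (hψ n).measurable.aestronglyMeasurable) ∧
      (∀ n, ∃ w, (hψ n).isSchurMultiplier.mul w = (hχ n).isSchurMultiplier.mul h) ∧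
      ∀ K : L2 μ →L[ℂ] L2 μ, Filter.Tendsto
        (fun n => pairing μ K ((hχ n).isSchurMultiplier.mul h)) Filter.atTop
          (𝓝 (pairing μ K h)) := by
  obtain ⟨f, g, H⟩ := h.2
  have hf := measurableSet_cutSet f
  have hg := measurableSet_cutSet g
  have htop : ∀ (f : ℕ → L2 μ) (n : ℕ), μ (cutSet f n) ≠ ∞ := fun f n =>
    ((measure_mono Set.inter_subset_right).trans_lt (measure_spanningSets_lt_top μ n)).ne
  have key : ∀ n, AEEqFun.mk (rect (cutSet f n) (cutSet g n) * ⇑h.1)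
      (isSqMultiplier_rect_mul H n).measurable.aestronglyMeasurable =
      AEEqFun.mk (rect (cutSet f n) (cutSet g n))
        (measurable_rect (hf n) (hg n)).aestronglyMeasurable * h.1 := fun n => by
    conv_rhs => rw [← AEEqFun.mk_coeFn h.1]
    rw [AEEqFun.mk_mul_mk]
  refine ⟨_, _, fun n => isSqMultiplier_rect μ (hf n) (hg n), isSqMultiplier_rect_mul H,
    -- The witness `w` is the indicator `χ n` itself, in `T(X)` because the sides of the rectangle
    -- have finite measure; `χ n * χ n = χ n` gives the identity.
    fun n => (key n).symm, fun n => ⟨⟨_, rect_mem_traceSpace (hf n) (hg n) (htop f n) (htop g n)⟩,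
      Subtype.ext ?_⟩, tendsto_pairing_rect_mul hf hg (ae_eventually_mem_cutSet H.summable_left)
        (ae_eventually_mem_cutSet H.summable_right) h⟩
  rw [IsSchurMultiplier.coe_mul, IsSchurMultiplier.coe_mul, key, mul_right_comm,
    AEEqFun.mk_mul_mk]
  congr 2
  exact rect_mul_rect _ _

/-! ### Invariance of closures and the annihilator argument. -/

/-- The adjoint operation sends compact annihilators of `S` to compact annihilators of `S`, since
`S` is invariant. -/
theorem IsSqMultiplier.mul_mem_closure {μ : Measure X} [SigmaFinite μ] {φ : X × X → ℂ}
    (hφ : IsSqMultiplier μ φ) {S : Submodule ℂ (traceSpace μ)} (hS : IsSchurInvariant S)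
    {h : traceSpace μ} (hh : h ∈ closure[weakStar μ] (S : Set (traceSpace μ))) :
    hφ.isSchurMultiplier.mul h ∈ closure[weakStar μ] (S : Set (traceSpace μ)) := by
  rw [mem_closure_weakStar_iff] at hh ⊢
  intro K hK hKS
  obtain ⟨L, hL, hKL⟩ := hφ.exists_pairing_mul hK
  rw [hKL]
  exact hh L hL fun u hu => (hKL u).symm.trans (hKS _ (hS φ _ u hu))

/-- If `K` annihilates `S ⊓ T`, then multiplying by a multiplier in the weak* closure of `T` maps
`S` into the annihilator of `K`. -/
theorem pairing_mul_eq_zero {μ : Measure X} [SigmaFinite μ] {S T : Submodule ℂ (traceSpace μ)}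
    (hS : IsSchurInvariant S) (hT : IsSchurInvariant T) {K : L2 μ →L[ℂ] L2 μ}
    (hK : IsCompactOperator K) (hKST : ∀ w ∈ S, w ∈ T → pairing μ K w = 0) {φ : X × X → ℂ}
    (hφ : IsSqMultiplier μ φ) {h : traceSpace μ}
    (hφh : h.1 = AEEqFun.mk φ hφ.measurable.aestronglyMeasurable)
    (hh : h ∈ closure[weakStar μ] (T : Set (traceSpace μ))) {u : traceSpace μ} (hu : u ∈ S) :
    pairing μ K (hφ.isSchurMultiplier.mul u) = 0 := by
  obtain ⟨L, hL, hKL⟩ := hφ.exists_pairing_mul hK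
  obtain ⟨χ, ψ, hχ, hψ, hχψ, -, hlim⟩ := exists_cutoff u
  rw [hKL]
  refine tendsto_nhds_unique (hlim L) (tendsto_const_nhds.congr fun n => ?_)
  obtain ⟨M, hM, hKM⟩ := (hψ n).exists_pairing_mul hK
  -- The roles are exchanged: `h`, until now the multiplier `φ`, becomes the vector, so that its
  -- membership in the closure of `T` can be used.
  have e : hφ.isSchurMultiplier.mul ((hχ n).isSchurMultiplier.mul u) =
      (hψ n).isSchurMultiplier.mul h := by
    refine Subtype.ext ?_
    rw [IsSchurMultiplier.coe_mul hφ.isSchurMultiplier, hχψ,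
      IsSchurMultiplier.coe_mul (hψ n).isSchurMultiplier, hφh, mul_comm]
  rw [← hKL, e, hKM]
  refine (mem_closure_weakStar_iff.1 hh M hM fun v hv => ?_).symm
  obtain ⟨χ', ψ', hχ', hψ', hχψ', -, hlim'⟩ := exists_cutoff v
  refine tendsto_nhds_unique (hlim' M) (tendsto_const_nhds.congr fun m => ?_)
  -- The same product is a multiple of `v` and a multiple of `u`, hence lies in both `T` and `S`.
  have e' : (hψ n).isSchurMultiplier.mul ((hχ' m).isSchurMultiplier.mul v) =
      (hψ' m).isSchurMultiplier.mul ((hχ n).isSchurMultiplier.mul u) := by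
    refine Subtype.ext ?_
    rw [IsSchurMultiplier.coe_mul (hψ n).isSchurMultiplier, hχψ',
      IsSchurMultiplier.coe_mul (hψ' m).isSchurMultiplier, hχψ, mul_comm]
  rw [← hKM]
  refine (hKST _ ?_ (hT _ _ _ (hT _ _ _ hv))).symm
  rw [e']
  exact hS _ _ _ (hS _ _ _ hu)

end SchurMult

theorem lemma4p1 {X : Type*} [MeasurableSpace X] [StandardBorelSpace X]
    (μ : Measure X) [SigmaFinite μ]
    (S T : Submodule ℂ (SchurMult.traceSpace μ))
    (hS : SchurMult.IsSchurInvariant S) (hT : SchurMult.IsSchurInvariant T)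
    (hST : closure[SchurMult.weakStar μ] ((S ⊔ T : Submodule ℂ (SchurMult.traceSpace μ)) :
      Set (SchurMult.traceSpace μ)) = Set.univ) :
    closure[SchurMult.weakStar μ] (S : Set (SchurMult.traceSpace μ)) ∩
        closure[SchurMult.weakStar μ] (T : Set (SchurMult.traceSpace μ)) =
      closure[SchurMult.weakStar μ] ((S ⊓ T : Submodule ℂ (SchurMult.traceSpace μ)) :
        Set (SchurMult.traceSpace μ)) := by
  refine Set.Subset.antisymm ?_ (Set.subset_inter
    (@closure_mono _ (SchurMult.weakStar μ) _ _ fun _ h => h.1)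
    (@closure_mono _ (SchurMult.weakStar μ) _ _ fun _ h => h.2))
  rintro h ⟨hhS, hhT⟩
  refine SchurMult.mem_closure_weakStar_iff.2 fun K hK hKST => ?_
  obtain ⟨χ, ψ, hχ, hψ, hχψ, hw, hlim⟩ := SchurMult.exists_cutoff h
  refine tendsto_nhds_unique (hlim K) (tendsto_const_nhds.congr fun n => ?_)
  obtain ⟨w, hw⟩ := hw n
  -- Since `χ n * h = ψ n * w`, the pairing becomes `⟨L, w⟩`; as `w` is in the closure of `S ⊔ T`,
  -- only the vanishing of `L` on `S` and on `T` remains.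
  obtain ⟨L, hL, hKL⟩ := (hψ n).exists_pairing_mul hK
  rw [← hw, hKL]
  have hmem : w ∈ closure[SchurMult.weakStar μ]
      ((S ⊔ T : Submodule ℂ (SchurMult.traceSpace μ)) : Set (SchurMult.traceSpace μ)) :=
    hST ▸ Set.mem_univ w
  refine (SchurMult.mem_closure_weakStar_iff.1 hmem L hL fun x hx => ?_).symm
  obtain ⟨u, hu, v, hv, rfl⟩ := Submodule.mem_sup.1 hx
  rw [SchurMult.pairing_add_right, ← hKL, ← hKL,
    SchurMult.pairing_mul_eq_zero hS hT hK (fun w h1 h2 => hKST w ⟨h1, h2⟩) (hψ n) (hχψ n)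
      ((hχ n).mul_mem_closure hT hhT) hu,
    SchurMult.pairing_mul_eq_zero hT hS hK (fun w h1 h2 => hKST w ⟨h2, h1⟩) (hψ n) (hχψ n)
      ((hχ n).mul_mem_closure hS hhS) hv, add_zero]
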